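/- All graphs are finite, simple and undirected. A graph $H$ is a *topological minor* of $G$ if some subdivision of $H$ is a subgraph of $G$. A *tree decomposition* of $G$ is a pair $(T,\mathcal{X})$, where $T$ is a (finite) rooted tree and $\mathcal{X}$ assigns to every node $t\in V(T)$ a bag $\mathcal{X}(t)\subseteq V(G)$, such that $\bigcup_t \mathcal{X}(t)=V(G)$, every edge of $G$ has both endpoints in a common bag, and for every $v\in V(G)$ the nodes $t$ with $v\in\mathcal{X}(t)$ induce a connected subtree of $T$. Its *width* is $\max_{t}|\mathcal{X}(t)|-1$; the *adhesion* of an edge $tt'$ of $T$ is the set $\mathcal{X}(t)\cap\mathcal{X}(t')$, and the adhesion of $(T,\mathcal{X})$ is $\max_{tt'\in E(T)}|\mathcal{X}(t)\cap\mathcal{X}(t')|$ (which is $0$ if $T$ has no edges). The *adhesion degree* of $(T,\mathcal{X})$ is the maximum over nodes $t$ of the number of distinct sets $\mathcal{X}(t)\cap\mathcal{X}(t')$, where $t'$ ranges over the neighbours of $t$ in $T$. The decomposition is *connected* if for every node $t$ and every child $t'$ of $t$, writing $Y$ for the union of the bags in the subtree of $T$ rooted at $t'$, the graph $G[Y\setminus\mathcal{X}(t)]$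 is connected (in particular nonempty) and every vertex of $\mathcal{X}(t)\cap\mathcal{X}(t')$ has a neighbour in $Y\setminus\mathcal{X}(t)$. **Lemma.** For every graph $H$ and every integer $h\ge 0$ there is an integer $f(h,H)\ge 0$, depending only on $h$ and $H$, such that the following holds. Let $\ell\ge 0$ be an integer, let $G$ be a graph not containing $H$ as a topological minor, and let $(T,\mathcal{X})$ be a connected tree decomposition of $G$ of width less than $\ell$ and adhesion at most $h$. Then the adhesion degree of $(T,\mathcal{X})$ is at most $f(h,H)\cdot\ell$. -/

import Mathlib

namespace AdhDeg

/-- `H` is a topological minor of `G`: some subdivision of `H` is a subgraph of `G`. That is, there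
are an injective choice `φ` of branch vertices and, for every edge `ab` of `H`, a path of `G` from
`φ a` to `φ b` that contains no other branch vertex, such that the paths of two distinct edges
of `H` meet in branch vertices only. -/
def IsTopologicalMinor {W V : Type*} (H : SimpleGraph W) (G : SimpleGraph V) : Prop :=
  ∃ (φ : W ↪ V) (P : ∀ a b : W, H.Adj a b → G.Walk (φ a) (φ b)),
    (∀ a b (e : H.Adj a b), (P a b e).IsPath) ∧
    (∀ a b (e : H.Adj a b) (w : W), φ w ∈ (P a b e).support → w = a ∨ w = b) ∧
    (∀ a b (e : H.Adj a b) c d (e' : H.Adj c d), s(a, b) ≠ s(c, d) →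
      ∀ x : V, x ∈ (P a b e).support → x ∈ (P c d e').support → x ∈ Set.range φ)

/-- A tree decomposition of `G`, over a rooted tree whose nodes are the elements of `τ`. -/
structure TreeDecomposition {V : Type*} (G : SimpleGraph V) (τ : Type*) where
  /-- the tree -/
  tree : SimpleGraph τ
  isTree : tree.IsTree
  /-- the root of the tree -/
  root : τ
  /-- the bag of every node -/
  bag : τ → Set V
  iUnion_bag : (⋃ t, bag t) = Set.univ
  exists_bag_of_adj : ∀ u v, G.Adj u v → ∃ t, u ∈ bag t ∧ v ∈ bag t
  connected_nodes : ∀ v, (tree.induce {t | v ∈ bag t}).Connected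

namespace TreeDecomposition

variable {V τ : Type*} {G : SimpleGraph V}

/-- The width `max_t |X(t)| - 1`, an integer (it is `-1` if all bags are empty). -/
noncomputable def width [Fintype τ] (D : TreeDecomposition G τ) : ℤ :=
  ((Finset.univ.sup fun t => (D.bag t).ncard : ℕ) : ℤ) - 1

open scoped Classical in
/-- The adhesion `max_{tt' ∈ E(T)} |X(t) ∩ X(t')|` (it is `0` if the tree has no edges). -/
noncomputable def adhesion [Fintype τ] (D : TreeDecomposition G τ) : ℕ :=
  (Finset.univ.filter fun p : τ × τ => D.tree.Adj p.1 p.2).sup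
    fun p => (D.bag p.1 ∩ D.bag p.2).ncard

/-- The distinct sets `X(t) ∩ X(t')`, where `t'` runs over the neighbours of `t` in the tree
(the parent of `t` and the children of `t`). -/
def adhesionsAt (D : TreeDecomposition G τ) (t : τ) : Set (Set V) :=
  {S | ∃ t', D.tree.Adj t t' ∧ S = D.bag t ∩ D.bag t'}

/-- The adhesion degree: the maximum over all nodes of the number of distinct adhesions there. -/
noncomputable def adhesionDegree [Fintype τ] (D : TreeDecomposition G τ) : ℕ :=
  Finset.univ.sup fun t => (D.adhesionsAt t).ncard

/-- The nodes of the subtree rooted at `t`: those `s` for which the path from the root to `s`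
passes through `t`. -/
def subtree (D : TreeDecomposition G τ) (t : τ) : Set τ :=
  {s | ∀ p : D.tree.Walk D.root s, p.IsPath → t ∈ p.support}

/-- `t'` is a child of `t`. -/
def IsChild (D : TreeDecomposition G τ) (t t' : τ) : Prop :=
  D.tree.Adj t t' ∧ t' ∈ D.subtree t

/-- The union of the bags in the subtree rooted at `t`. -/
def subtreeBag (D : TreeDecomposition G τ) (t : τ) : Set V :=
  ⋃ s ∈ D.subtree t, D.bag s

/-- A tree decomposition is connected if for every node `t` and every child `t'` of `t`, the set
of vertices in bags of the subtree at `t'` but not in the bag of `t` induces a connected (in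
particular nonempty) subgraph, which has edges to every vertex of the adhesion of `tt'`. -/
def IsConnected (D : TreeDecomposition G τ) : Prop :=
  ∀ t t', D.IsChild t t' →
    (G.induce (D.subtreeBag t' \ D.bag t)).Connected ∧
    ∀ v ∈ D.bag t ∩ D.bag t', ∃ u ∈ D.subtreeBag t' \ D.bag t, G.Adj u v

end TreeDecomposition

end AdhDeg

/-! Fix a node `t` with bag X. Its distinct child adhesions S_i are subsets of X, each fully
attached to a connected set C_i; the C_i avoid X and are pairwise disjoint. Choose distinct pairs
e_i ⊆ S_i for a maximal set of indices, and let F be the graph of these pairs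
(`exists_maximal_pairs`). A dense subgraph of F would contain a subdivision of H by Mader's theorem
(`exists_hasSubdivision_of_le_degSum`), and replacing each edge e_i by a detour through C_i would
carry it into G (`HasSubdivision.of_routed`).

So F is sparse on X. It has O(|X|) edges, which bounds the indices with a pair, and O(|X|) cliques
(`card_cliques_le`), which bounds the others: by maximality, an S_i without a pair is a clique of F.
The parent contributes at most one further adhesion. -/

namespace AdhDeg

open Finset
open scoped Classical

/-- Any two vertices of `U` are joined by a walk inside `U`. -/
def WalkConnected {V : Type*} (G : SimpleGraph V) (U : Set V) : Prop :=
  ∀ x ∈ U, ∀ y ∈ U, ∃ p : G.Walk x y, ∀ z ∈ p.support, z ∈ U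

/-- `G[A]` contains a subdivision of the graph with vertex set `W` and edge set `E`, where the
interior of the path that replaces the edge `e` lies in `I e`. -/
def HasSubdivision {W V : Type*} (E : Set (Sym2 W)) (G : SimpleGraph V) (A : Set V) : Prop :=
  ∃ (φ : W ↪ V) (I : Sym2 W → Set V), (∀ w, φ w ∈ A) ∧ (∀ e ∈ E, I e ⊆ A) ∧
    (∀ e ∈ E, ∀ w, φ w ∉ I e) ∧ E.PairwiseDisjoint I ∧
    ∀ a b, s(a, b) ∈ E → ∃ p : G.Walk (φ a) (φ b),
      ∀ x ∈ p.support, x = φ a ∨ x = φ b ∨ x ∈ I s(a, b)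

/-! ### Degree sums and contraction of connected sets -/

section Density

variable {V : Type*} (G : SimpleGraph V)

/-- The neighbours of `v` in `A`. -/
noncomputable def nbrs (A : Finset V) (v : V) : Finset V := A.filter fun w => G.Adj v w

/-- The vertices of `A` that have a neighbour in `U`. -/
noncomputable def boundary (A U : Finset V) : Finset V := A.filter fun w => ∃ u ∈ U, G.Adj u w

/-- The sum of the degrees of the graph induced on `A`. -/
noncomputable def degSum (A : Finset V) : ℕ := ∑ v ∈ A, #(nbrs G A v)

variable {G}

theorem mem_nbrs {A : Finset V} {v w : V} : w ∈ nbrs G A v ↔ w ∈ A ∧ G.Adj v w := by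
  simp [nbrs]

theorem mem_boundary {A U : Finset V} {w : V} :
    w ∈ boundary G A U ↔ w ∈ A ∧ ∃ u ∈ U, G.Adj u w := by
  simp [boundary]

theorem degSum_le_erase {A : Finset V} {v : V} (hv : v ∈ A) :
    degSum G A ≤ degSum G (A.erase v) + 2 * #(nbrs G A v) := by
  have h1 : ∀ x ∈ A.erase v, #(nbrs G A x) ≤ #(nbrs G (A.erase v) x) + if G.Adj v x then 1 else 0 := by
    intro x hx
    split_ifs with h
    · have : nbrs G A x ⊆ insert v (nbrs G (A.erase v) x) := by
        intro y hy
        simp only [mem_nbrs, mem_insert, mem_erase] at hy ⊢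
        tauto
      exact (card_le_card this).trans (card_insert_le _ _)
    · refine card_le_card fun y hy => ?_
      simp only [mem_nbrs, mem_erase] at hy ⊢
      refine ⟨⟨?_, hy.1⟩, hy.2⟩
      rintro rfl
      exact h hy.2.symm
  have h2 : (∑ x ∈ A.erase v, if G.Adj v x then 1 else 0) ≤ #(nbrs G A v) := by
    rw [← card_filter]
    refine card_le_card fun y hy => ?_
    simp only [mem_nbrs, mem_filter, mem_erase] at hy ⊢
    tauto
  have h3 := sum_le_sum h1
  rw [sum_add_distrib] at h3
  have h4 := add_sum_erase A (fun x => #(nbrs G A x)) hv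
  simp only [degSum] at *
  omega

theorem le_degSum {A : Finset V} {c : ℕ} (h : ∀ v ∈ A, c ≤ #(nbrs G A v)) :
    c * #A ≤ degSum G A := by
  have := card_nsmul_le_sum A (fun v => #(nbrs G A v)) c h
  rwa [smul_eq_mul, mul_comm] at this

theorem exists_card_nbrs_lt {A : Finset V} {c : ℕ} (h : degSum G A < c * #A) :
    ∃ v ∈ A, #(nbrs G A v) < c := by
  by_contra! h'
  exact absurd (le_degSum h') (by omega)

theorem WalkConnected.insert {U : Set V} (hU : WalkConnected G U) {u v : V} (hu : u ∈ U)
    (huv : G.Adj u v) : WalkConnected G (insert v U) := by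
  have key : ∀ x ∈ Insert.insert v U, ∃ p : G.Walk x u, ∀ z ∈ p.support, z ∈ Insert.insert v U := by
    rintro x (rfl | hx)
    · refine ⟨.cons huv.symm .nil, ?_⟩
      simp [hu]
    · obtain ⟨p, hp⟩ := hU x hx u hu
      exact ⟨p, fun z hz => Or.inr (hp z hz)⟩
  intro x hx y hy
  obtain ⟨p, hp⟩ := key x hx
  obtain ⟨q, hq⟩ := key y hy
  refine ⟨p.append q.reverse, fun z hz => ?_⟩
  rw [SimpleGraph.Walk.mem_support_append_iff, SimpleGraph.Walk.support_reverse,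
    List.mem_reverse] at hz
  exact hz.elim (hp z) (hq z)

theorem walkConnected_singleton (v : V) : WalkConnected G {v} := by
  rintro x rfl y rfl
  exact ⟨.nil, by simp⟩

/-- Contracting a single vertex changes nothing. The two sides compare order and degree sum of the
graph in which the connected set has become one vertex; this starts, or restarts, the contraction
process. -/
theorem contraction_singleton {A : Finset V} {c : ℕ} {v : V} (hv : v ∈ A)
    (h : 2 * c * #A ≤ degSum G A) :
    2 * c * (#(A.erase v) + 1) ≤
      degSum G (A.erase v) + 2 * #(boundary G (A.erase v) {v}) := by
  have h1 := degSum_le_erase (G := G) hv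
  have h2 : nbrs G A v ⊆ boundary G (A.erase v) {v} := by
    intro y hy
    simp only [mem_nbrs, mem_boundary, mem_erase, mem_singleton, exists_eq_left] at hy ⊢
    exact ⟨⟨hy.2.ne', hy.1⟩, hy.2⟩
  have h3 := card_le_card h2
  rw [card_erase_add_one hv]
  omega

/-- If contracting a connected set `U` leaves a dense graph on `R` and the new vertex, then there
is a connected set all of whose attached vertices induce a graph of large minimum degree. -/
theorem exists_dense_boundary {c : ℕ} (hc : 0 < c) (R : Finset V) : ∀ U : Finset V,
    Disjoint R U → WalkConnected G (U : Set V) →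
    2 * c * (#R + 1) ≤ degSum G R + 2 * #(boundary G R U) →
    ∃ N U' : Finset V, N.Nonempty ∧ Disjoint N U' ∧ N ⊆ R ∧ U' ⊆ R ∪ U ∧
      WalkConnected G (U' : Set V) ∧ (∀ v ∈ N, ∃ u ∈ U', G.Adj u v) ∧ c * #N ≤ degSum G N := by
  induction R using Finset.strongInduction with
  | H R ih =>
  intro U hd hU h
  by_cases hN : (boundary G R U).Nonempty
  · by_cases hdeg : ∀ v ∈ boundary G R U, c ≤ #(nbrs G (boundary G R U) v)
    · refine ⟨boundary G R U, U, hN, hd.mono_left (filter_subset _ _), filter_subset _ _,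
        subset_union_right, hU, fun v hv => (mem_boundary.1 hv).2, le_degSum hdeg⟩
    -- Absorbing `v` into `U` costs one vertex and at most `c` edges: the edge to the contracted
    -- vertex and fewer than `c` doubled edges. The average degree stays at least `2 * c`.
    · push Not at hdeg
      obtain ⟨v, hv, hlt⟩ := hdeg
      obtain ⟨hvR, u, hu, huv⟩ := mem_boundary.1 hv
      have hcon : WalkConnected G ((insert v U : Finset V) : Set V) := by
        rw [coe_insert]
        exact hU.insert (mem_coe.2 hu) huv
      have hdis : Disjoint (R.erase v) (insert v U) := by
        rw [disjoint_insert_right]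
        exact ⟨notMem_erase _ _, hd.mono_left (erase_subset _ _)⟩
      have hcount : #(nbrs G R v) + #(boundary G R U) ≤
          #(boundary G (R.erase v) (insert v U)) + 1 + #(nbrs G (boundary G R U) v) := by
        have h1 : nbrs G R v ∪ boundary G R U ⊆
            insert v (boundary G (R.erase v) (insert v U)) := by
          intro y hy
          simp only [mem_union, mem_nbrs, mem_boundary, mem_insert, mem_erase] at hy ⊢
          by_cases hyv : y = v
          · exact Or.inl hyv
          · right
            rcases hy with ⟨hyR, ha⟩ | ⟨hyR, u, hu, ha⟩
            · exact ⟨⟨hyv, hyR⟩, v, Or.inl rfl, ha⟩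
            · exact ⟨⟨hyv, hyR⟩, u, Or.inr hu, ha⟩
        have h2 : nbrs G R v ∩ boundary G R U ⊆ nbrs G (boundary G R U) v := by
          intro y hy
          simp only [mem_inter, mem_nbrs] at hy ⊢
          tauto
        have h3 := (card_le_card h1).trans (card_insert_le _ _)
        have h4 := card_le_card h2
        have h5 := card_union_add_card_inter (nbrs G R v) (boundary G R U)
        omega
      have hds := degSum_le_erase (G := G) hvR
      obtain ⟨N, U', h1, h2, h3, h4, h5⟩ := ih (R.erase v) (erase_ssubset hvR) (insert v U) hdis
        hcon (by
          have := card_erase_add_one hvR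
          rw [this]
          rw [mul_add] at h
          omega)
      refine ⟨N, U', h1, h2, h3.trans (erase_subset _ _), h4.trans ?_, h5⟩
      intro y hy
      simp only [mem_union, mem_erase, mem_insert] at hy ⊢
      rcases hy with hy | rfl | hy
      · exact Or.inl hy.2
      · exact Or.inl hvR
      · exact Or.inr hy
  -- The contracted vertex is isolated, so it is discarded and contraction restarts from a vertex of
  -- `R`.
  · rw [not_nonempty_iff_eq_empty] at hN
    rw [hN, card_empty, mul_zero, add_zero] at h
    obtain ⟨v, hv⟩ : R.Nonempty := by
      by_contra hR
      rw [not_nonempty_iff_eq_empty] at hR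
      subst hR
      simp [degSum] at h
      omega
    obtain ⟨N, U', h1, h2, h3, h4, h5⟩ := ih (R.erase v) (erase_ssubset hv) {v} (by simp)
      (by simpa using walkConnected_singleton v)
      (contraction_singleton hv (le_trans (Nat.mul_le_mul_left _ (Nat.le_succ _)) h))
    refine ⟨N, U', h1, h2, h3.trans (erase_subset _ _), h4.trans ?_, h5⟩
    intro y hy
    simp only [mem_union, mem_erase, mem_singleton] at hy ⊢
    rcases hy with hy | rfl
    · exact Or.inl hy.2
    · exact Or.inl hv

end Density

/-! ### Mader's theorem -/

/-- One more edge can be routed through a connected set attached to all vertices of `N`. -/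
theorem HasSubdivision.insert {W V : Type*} {G : SimpleGraph V} {E : Set (Sym2 W)} {N U A : Set V}
    (h : HasSubdivision E G N) {e : Sym2 W} (he : e ∉ E) (hd : Disjoint N U) (hN : N ⊆ A)
    (hUA : U ⊆ A) (hU : WalkConnected G U) (hNU : ∀ v ∈ N, ∃ u ∈ U, G.Adj u v) :
    HasSubdivision (insert e E) G A := by
  obtain ⟨φ, I, hφ, hI, hφI, hdisj, hw⟩ := h
  have hne : ∀ e' ∈ E, e' ≠ e := fun e' he' h => he (h ▸ he')
  have hIe : ∀ e' ∈ E, Function.update I e U e' = I e' := fun e' he' =>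
    Function.update_of_ne (hne e' he') _ _
  refine ⟨φ, Function.update I e U, fun w => hN (hφ w), ?_, ?_, ?_, ?_⟩
  · rintro e' (rfl | he')
    · simpa using hUA
    · rw [hIe _ he']
      exact (hI _ he').trans hN
  · rintro e' (rfl | he') w
    · simpa using hd.notMem_of_mem_left (hφ w)
    · rw [hIe _ he']
      exact hφI _ he' w
  · refine Set.PairwiseDisjoint.insert_of_notMem ?_ he ?_
    · intro e₁ h₁ e₂ h₂ h12
      simpa only [Function.onFun, hIe _ h₁, hIe _ h₂] using hdisj h₁ h₂ h12
    · intro e' he'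
      rw [hIe _ he', Function.update_self]
      exact (hd.mono_left (hI _ he')).symm
  · rintro a b (hab | hab)
    · obtain ⟨u, hu, hua⟩ := hNU _ (hφ a)
      obtain ⟨v, hv, hvb⟩ := hNU _ (hφ b)
      obtain ⟨p, hp⟩ := hU u hu v hv
      refine ⟨.cons hua.symm (p.concat hvb), fun x hx => ?_⟩
      rw [SimpleGraph.Walk.support_cons, SimpleGraph.Walk.support_concat] at hx
      simp only [List.mem_cons, List.mem_append, List.not_mem_nil,
        or_false] at hx
      rw [hab, Function.update_self]
      rcases hx with hx | hx | hx
      · exact Or.inl hx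
      · exact Or.inr (Or.inr (hp x hx))
      · exact Or.inr (Or.inl hx)
    · rw [hIe _ hab]
      exact hw a b hab

/-- Mader's theorem: graphs of large average degree contain a subdivision of any given graph. -/
theorem exists_hasSubdivision_of_le_degSum {W : Type*} [Finite W] (E : Set (Sym2 W)) :
    ∃ c : ℕ, 0 < c ∧ ∀ {V : Type*} (G : SimpleGraph V) (A : Finset V), A.Nonempty →
      c * #A ≤ degSum G A → HasSubdivision E G A := by
  induction E, E.toFinite using Set.Finite.induction_on with
  | empty =>
    -- The degree sum is at most `#A * #A`, so this constant forces room for all branch vertices.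
    refine ⟨Nat.card W + 1, Nat.succ_pos _, fun {V} G A hA h => ?_⟩
    have h1 : degSum G A ≤ #A * #A := by
      rw [← smul_eq_mul]
      exact sum_le_card_nsmul _ _ _ fun v _ => card_le_card (filter_subset _ _)
    have h2 : Nat.card W + 1 ≤ #A := Nat.le_of_mul_le_mul_right (h.trans h1) hA.card_pos
    have := Fintype.ofFinite W
    obtain ⟨f⟩ : Nonempty (W ↪ A) := by
      refine Function.Embedding.nonempty_of_card_le ?_
      rw [Fintype.card_coe, ← Nat.card_eq_fintype_card]
      omega
    exact ⟨f.trans (.subtype _), fun _ => ∅, fun w => (f w).2, by simp⟩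
  | @insert e E he _ ih =>
    obtain ⟨c, hc, ih⟩ := ih
    -- Each edge doubles the constant: `N` keeps half the density for the remaining edges, while `U`
    -- stays free to carry the new one.
    refine ⟨2 * c, by omega, fun {V} G A hA h => ?_⟩
    obtain ⟨v, hv⟩ := hA
    obtain ⟨N, U, hN, hd, hNA, hUA, hU, hNU, hdeg⟩ := exists_dense_boundary (G := G) hc (A.erase v) {v}
      (by simp) (by simpa using walkConnected_singleton v) (contraction_singleton hv h)
    have hUA' : U ⊆ A := by
      intro y hy
      have := hUA hy
      simp only [mem_union, mem_erase, mem_singleton] at this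
      rcases this with h | rfl
      · exact h.2
      · exact hv
    exact (ih G N hN hdeg).insert he (by exact_mod_cast hd)
      (by exact_mod_cast hNA.trans (erase_subset _ _)) (by exact_mod_cast hUA') hU
      (by simpa using hNU)

/-- A graph all of whose subgraphs are sparse has linearly many cliques. -/
theorem card_cliques_le {V : Type*} {G : SimpleGraph V} {c : ℕ} (A : Finset V) :
    (∀ B ⊆ A, B.Nonempty → degSum G B < c * #B) →
      #(A.powerset.filter fun S : Finset V => G.IsClique (S : Set V)) ≤ 2 ^ c * #A + 1 := by
  induction A using Finset.strongInduction with
  | H A ih =>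
  intro h
  rcases A.eq_empty_or_nonempty with rfl | hA
  · exact (card_filter_le _ _).trans (by simp)
  -- A clique through `v` is determined by its trace on the fewer than `c` neighbours of `v`.
  · obtain ⟨v, hv, hlt⟩ := exists_card_nbrs_lt (h A subset_rfl hA)
    have h1 := ih (A.erase v) (erase_ssubset hv) fun B hB => h B (hB.trans (erase_subset _ _))
    have h2 : A.powerset.filter (fun S : Finset V => G.IsClique (S : Set V)) ⊆
        (A.erase v).powerset.filter (fun S : Finset V => G.IsClique (S : Set V)) ∪
          (nbrs G A v).powerset.image (insert v) := by
      intro S hS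
      simp only [mem_filter, mem_powerset] at hS
      by_cases hvS : v ∈ S
      · refine mem_union_right _ (mem_image.2 ⟨S.erase v, mem_powerset.2 fun y hy => ?_,
          insert_erase hvS⟩)
        rw [mem_erase] at hy
        exact mem_nbrs.2 ⟨hS.1 hy.2, hS.2 hvS hy.2 hy.1.symm⟩
      · exact mem_union_left _ (mem_filter.2
          ⟨mem_powerset.2 (subset_erase.2 ⟨hS.1, hvS⟩), hS.2⟩)
    have h3 : #((nbrs G A v).powerset.image (insert v)) ≤ 2 ^ c :=
      card_image_le.trans (by
        rw [card_powerset]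
        exact Nat.pow_le_pow_right two_pos hlt.le)
    have h4 := (card_le_card h2).trans (card_union_le _ _)
    have h5 : 2 ^ c * #A = 2 ^ c * #(A.erase v) + 2 ^ c := by
      rw [← card_erase_add_one hv, mul_add, mul_one]
    omega

/-- Shortcutting walks to paths only shrinks their supports, so disjointness survives. -/
theorem HasSubdivision.isTopologicalMinor {W V : Type*} {H : SimpleGraph W} {G : SimpleGraph V}
    {A : Set V} (h : HasSubdivision H.edgeSet G A) : IsTopologicalMinor H G := by
  obtain ⟨φ, I, -, -, hφI, hdisj, hw⟩ := h
  choose p hp using hw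
  have hs : ∀ a b (e : H.Adj a b), ∀ x ∈ (p a b e).bypass.support,
      x = φ a ∨ x = φ b ∨ x ∈ I s(a, b) :=
    fun a b e x hx => hp a b e x ((p a b e).support_bypass_subset_support hx)
  refine ⟨φ, fun a b e => (p a b e).bypass, fun a b e => (p a b e).bypass_isPath, ?_, ?_⟩
  · intro a b e w hx
    rcases hs a b e _ hx with h | h | h
    · exact Or.inl (φ.injective h)
    · exact Or.inr (φ.injective h)
    · exact absurd h (hφI _ e w)
  · intro a b e c d e' hne x hx hx'
    rcases hs a b e x hx with h | h | h
    · exact ⟨a, h.symm⟩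
    · exact ⟨b, h.symm⟩
    rcases hs c d e' x hx' with h' | h' | h'
    · exact ⟨c, h'.symm⟩
    · exact ⟨d, h'.symm⟩
    · exact absurd h' (Set.disjoint_left.1 (hdisj e e' hne) h)

/-! ### Virtual edges and their routing through connected sets -/

section Routing

variable {V ι : Type*} {G : SimpleGraph V} {S C : ι → Set V} {M : Set ι} {e : ι → Sym2 V}

/-- The union of the sets `C i` over the indices `i` in `M` whose edge `e i` lies in `T`. -/
def routes (C : ι → Set V) (M : Set ι) (e : ι → Sym2 V) (T : Set V) : Set V :=
  {x | ∃ i ∈ M, (∀ y ∈ e i, y ∈ T) ∧ x ∈ C i}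

/-- Each edge `e i` of the walk is traded for a detour through `C i`, to which both its ends attach.
Only pairs inside `T` are used, which keeps the routes of different edges of `H` apart. -/
theorem exists_routed_walk (hconn : ∀ i, WalkConnected G (C i))
    (hatt : ∀ i, ∀ v ∈ S i, ∃ u ∈ C i, G.Adj u v) (heS : ∀ i ∈ M, ∀ x ∈ e i, x ∈ S i)
    {T : Set V} {u v : V} (p : (SimpleGraph.fromEdgeSet (e '' M)).Walk u v) :
    (∀ x ∈ p.support, x ∈ T) → ∃ q : G.Walk u v, ∀ x ∈ q.support, x ∈ T ∨ x ∈ routes C M e T := by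
  induction p with
  | nil => exact fun hT => ⟨.nil, fun x hx => Or.inl (hT x hx)⟩
  | @cons u v w huv p ih =>
    intro hT
    rw [SimpleGraph.Walk.support_cons] at hT
    have hu : u ∈ T := hT u List.mem_cons_self
    have hv : v ∈ T := hT v (List.mem_cons_of_mem _ p.start_mem_support)
    obtain ⟨q, hq⟩ := ih fun x hx => hT x (List.mem_cons_of_mem _ hx)
    obtain ⟨⟨i, hi, hie⟩, -⟩ := (SimpleGraph.fromEdgeSet_adj _).1 huv
    have hS := heS i hi
    rw [hie] at hS
    obtain ⟨u', hu', hau⟩ := hatt i u (hS u (by simp))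
    obtain ⟨v', hv', hav⟩ := hatt i v (hS v (by simp))
    obtain ⟨r, hr⟩ := hconn i u' hu' v' hv'
    refine ⟨.cons hau.symm (r.append (.cons hav q)), fun x hx => ?_⟩
    rw [SimpleGraph.Walk.support_cons, List.mem_cons, SimpleGraph.Walk.mem_support_append_iff,
      SimpleGraph.Walk.support_cons, List.mem_cons] at hx
    have hC : ∀ x ∈ C i, x ∈ routes C M e T := fun x hx => ⟨i, hi, by
      rw [hie]
      intro y hy
      rcases Sym2.mem_iff.1 hy with rfl | rfl
      exacts [hu, hv], hx⟩
    rcases hx with rfl | hx | rfl | hx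
    · exact Or.inl hu
    · exact Or.inr (hC _ (hr x hx))
    · exact Or.inr (hC _ hv')
    · exact hq x hx

/-- A subdivision in the graph of virtual edges `e i` yields one in the graph in which each of
these edges is routed through a connected set `C i`. -/
theorem HasSubdivision.of_routed {W : Type*} {H : SimpleGraph W} {X : Set V}
    (hconn : ∀ i, WalkConnected G (C i))
    (hatt : ∀ i, ∀ v ∈ S i, ∃ u ∈ C i, G.Adj u v) (heS : ∀ i ∈ M, ∀ x ∈ e i, x ∈ S i)
    (hdisj : Pairwise fun i j => Disjoint (C i) (C j)) (hCX : ∀ i, Disjoint (C i) X)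
    (hdiag : ∀ i ∈ M, ¬ (e i).IsDiag)
    (h : HasSubdivision H.edgeSet (SimpleGraph.fromEdgeSet (e '' M)) X) :
    HasSubdivision H.edgeSet G Set.univ := by
  obtain ⟨φ, I, hφ, hI, hφI, hdI, hw⟩ := h
  let T : Sym2 W → Set V := fun f => {x | (∃ w ∈ f, φ w = x) ∨ x ∈ I f}
  have hrX : ∀ f, Disjoint (routes C M e (T f)) X := by
    intro f
    rw [Set.disjoint_left]
    rintro x ⟨i, -, -, hx⟩
    exact Set.disjoint_left.1 (hCX i) hx
  refine ⟨φ, fun f => I f ∪ routes C M e (T f), fun _ => trivial, fun _ _ => Set.subset_univ _,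
    ?_, ?_, ?_⟩
  · rintro f hf w (hw | hw)
    · exact hφI f hf w hw
    · exact Set.disjoint_left.1 (hrX f) hw (hφ w)
  · intro f hf g hg hfg
    simp only [Function.onFun]
    rw [Set.disjoint_union_left, Set.disjoint_union_right, Set.disjoint_union_right]
    refine ⟨⟨hdI hf hg hfg, ((hrX g).mono_right (hI f hf)).symm⟩, (hrX f).mono_right (hI g hg), ?_⟩
    rw [Set.disjoint_left]
    rintro x ⟨i, hi, hiT, hx⟩ ⟨j, hj, hjT, hx'⟩
    obtain rfl : i = j := by
      by_contra hij
      exact Set.disjoint_left.1 (hdisj hij) hx hx'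
    -- If `C i` served both `f` and `g`, the two ends of `e i` would be branch vertices common to
    -- `f` and `g`; two distinct common ends force `f = g`.
    have key : ∀ y ∈ e i, ∃ w, w ∈ f ∧ w ∈ g ∧ φ w = y := by
      intro y hy
      rcases hiT y hy with ⟨w, hwf, rfl⟩ | h1
      · rcases hjT _ hy with ⟨w', hwg, h2⟩ | h2
        · exact ⟨w, hwf, φ.injective h2 ▸ hwg, rfl⟩
        · exact absurd h2 (hφI g hg w)
      · rcases hjT _ hy with ⟨w', hwg, rfl⟩ | h2
        · exact absurd h1 (hφI f hf w')
        · exact absurd h2 (Set.disjoint_left.1 (hdI hf hg hfg) h1)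
    have hd := hdiag i hi
    generalize e i = s at key hd
    induction s with
    | _ a b =>
    obtain ⟨w, hwf, hwg, rfl⟩ := key a (by simp)
    obtain ⟨w', hwf', hwg', rfl⟩ := key b (by simp)
    have hne : w ≠ w' := by
      rintro rfl
      exact hd rfl
    exact hfg (((Sym2.mem_and_mem_iff hne).1 ⟨hwf, hwf'⟩).trans
      ((Sym2.mem_and_mem_iff hne).1 ⟨hwg, hwg'⟩).symm)
  · intro a b hab
    obtain ⟨p, hp⟩ := hw a b hab
    obtain ⟨q, hq⟩ := exists_routed_walk hconn hatt heS (T := T s(a, b)) p (by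
      intro x hx
      rcases hp x hx with rfl | rfl | h
      · exact Or.inl ⟨a, by simp, rfl⟩
      · exact Or.inl ⟨b, by simp, rfl⟩
      · exact Or.inr h)
    refine ⟨q, fun x hx => ?_⟩
    rcases hq x hx with (⟨w, hwab, rfl⟩ | h) | h
    · rcases Sym2.mem_iff.1 hwab with rfl | rfl
      · exact Or.inl rfl
      · exact Or.inr (Or.inl rfl)
    · exact Or.inr (Or.inr (Or.inl h))
    · exact Or.inr (Or.inr (Or.inr h))

/-- Nondiagonal pairs chosen from as many of the sets `S i` as possible, all distinct: the sets
from which none was chosen are cliques in the graph of the chosen pairs. -/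
theorem exists_maximal_pairs [Finite ι] [Nonempty V] (S : ι → Set V) :
    ∃ (M : Set ι) (e : ι → Sym2 V), (∀ i ∈ M, ∀ x ∈ e i, x ∈ S i) ∧ (∀ i ∈ M, ¬ (e i).IsDiag) ∧
      Set.InjOn e M ∧ ∀ i ∉ M, (SimpleGraph.fromEdgeSet (e '' M)).IsClique (S i) := by
  let P : Set (Set ι) := {M | ∃ e : ι → Sym2 V, (∀ i ∈ M, ∀ x ∈ e i, x ∈ S i) ∧
    (∀ i ∈ M, ¬ (e i).IsDiag) ∧ Set.InjOn e M}
  obtain ⟨v₀⟩ := ‹Nonempty V›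
  obtain ⟨M, ⟨e, h1, h2, h3⟩, hmax⟩ := (Set.toFinite P).exists_maximal
    ⟨∅, fun _ => s(v₀, v₀), by simp, by simp, by simp⟩
  refine ⟨M, e, h1, h2, h3, fun i hi x hx y hy hxy => ?_⟩
  by_contra hadj
  rw [SimpleGraph.fromEdgeSet_adj] at hadj
  have hnot : s(x, y) ∉ e '' M := fun h => hadj ⟨h, hxy⟩
  have hupd : ∀ j ∈ M, Function.update e i s(x, y) j = e j := fun j hj =>
    Function.update_of_ne (by rintro rfl; exact hi hj) _ _
  -- A missing pair in `S i` could be chosen for `i`, contradicting maximality.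
  refine hi (hmax (y := insert i M) ⟨Function.update e i s(x, y), ?_, ?_, ?_⟩
    (Set.subset_insert _ _) (Set.mem_insert _ _))
  · rintro j (rfl | hj)
    · rw [Function.update_self]
      intro z hz
      rcases Sym2.mem_iff.1 hz with rfl | rfl
      exacts [hx, hy]
    · rw [hupd j hj]
      exact h1 j hj
  · rintro j (rfl | hj)
    · rw [Function.update_self]
      exact hxy
    · rw [hupd j hj]
      exact h2 j hj
  · rw [Set.injOn_insert hi]
    refine ⟨fun j hj k hk hjk => h3 hj hk (by rwa [hupd j hj, hupd k hk] at hjk), ?_⟩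
    rintro ⟨j, hj, hje⟩
    rw [hupd j hj, Function.update_self] at hje
    exact hnot ⟨j, hj, hje⟩

end Routing

/-! ### Counting attached sets -/

/-- In a graph without a subdivision of `H`, a vertex set `X` has only linearly many distinct
subsets that are attached to pairwise disjoint connected sets outside of `X`. -/
theorem card_attached_le {V ι W : Type*} {G : SimpleGraph V} {H : SimpleGraph W} {c : ℕ}
    [Fintype ι] {C : ι → Set V}
    (hc : ∀ (G' : SimpleGraph V) (A : Finset V), A.Nonempty → c * #A ≤ degSum G' A →
      HasSubdivision H.edgeSet G' A)
    (hH : ¬ IsTopologicalMinor H G) (X : Finset V) (S : ι → Finset V)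
    (hSX : ∀ i, S i ⊆ X) (hS : Function.Injective S)
    (hconn : ∀ i, WalkConnected G (C i))
    (hatt : ∀ i, ∀ v ∈ S i, ∃ u ∈ C i, G.Adj u v)
    (hdisj : Pairwise fun i j => Disjoint (C i) (C j)) (hCX : ∀ i, Disjoint (C i) (X : Set V)) :
    Fintype.card ι ≤ (c + 2 ^ c) * #X + 1 := by
  rcases isEmpty_or_nonempty V with hV | hV
  · have := hS.subsingleton
    exact Fintype.card_le_one_iff_subsingleton.2 this |>.trans (Nat.le_add_left _ _)
  obtain ⟨M, e, heS, hdiag, hinj, hcl⟩ := exists_maximal_pairs fun i => (S i : Set V)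
  set F := SimpleGraph.fromEdgeSet (e '' M) with hF
  have hsparse : ∀ B ⊆ X, B.Nonempty → degSum F B < c * #B := by
    intro B hB hBne
    by_contra! hlt
    exact hH ((hc F B hBne hlt).of_routed hconn hatt heS hdisj
      (fun i => (hCX i).mono_right (coe_subset.2 hB)) hdiag).isTopologicalMinor
  have hM : #(univ.filter (· ∈ M)) ≤ c * #X := by
    have h1 : #(univ.filter (· ∈ M)) ≤ #(X.sigma (nbrs F X)) := by
      -- One orientation of each chosen pair is counted, so the degree sum of `F` bounds their
      -- number.
      refine card_le_card_of_injOn (fun i => ⟨(e i).out.1, (e i).out.2⟩) ?_ ?_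
      · intro i hi
        have hi : i ∈ M := by simpa using hi
        have hout : s((e i).out.1, (e i).out.2) = e i := Quot.out_eq (e i)
        have h1 := hSX i (heS i hi _ (Sym2.out_fst_mem (e i)))
        have h2 := hSX i (heS i hi _ (Sym2.out_snd_mem (e i)))
        simp only [mem_coe, mem_sigma, mem_nbrs]
        refine ⟨h1, h2, (SimpleGraph.fromEdgeSet_adj _).2 ⟨⟨i, hi, hout.symm⟩, fun heq => ?_⟩⟩
        apply hdiag i hi
        rw [← hout]
        exact heq
      · intro i hi j hj hij
        have hi : i ∈ M := by simpa using hi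
        have hj : j ∈ M := by simpa using hj
        have hi' : s((e i).out.1, (e i).out.2) = e i := Quot.out_eq (e i)
        have hj' : s((e j).out.1, (e j).out.2) = e j := Quot.out_eq (e j)
        simp only [Sigma.mk.injEq, heq_eq_eq] at hij
        exact hinj hi hj (by rw [← hi', ← hj', hij.1, hij.2])
    rw [card_sigma] at h1
    refine h1.trans ?_
    rcases X.eq_empty_or_nonempty with rfl | hX
    · simp
    · exact (hsparse X subset_rfl hX).le
  have hN : #(univ.filter (· ∉ M)) ≤ 2 ^ c * #X + 1 := by
    refine le_trans ?_ (card_cliques_le X hsparse)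
    refine card_le_card_of_injOn S ?_ hS.injOn
    intro i hi
    have hi : i ∉ M := by simpa using hi
    simpa using ⟨hSX i, hcl i hi⟩
  have := card_filter_add_card_filter_not (s := (univ : Finset ι)) (· ∈ M)
  rw [card_univ] at this
  rw [add_mul]
  omega

theorem walkConnected_of_induce_connected {V : Type*} {G : SimpleGraph V} {A : Set V}
    (h : (G.induce A).Connected) : WalkConnected G A := by
  intro x hx y hy
  obtain ⟨p⟩ := h.preconnected ⟨x, hx⟩ ⟨y, hy⟩
  have hp : ∀ z ∈ (p.map (SimpleGraph.Embedding.induce A).toHom).support, z ∈ A := by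
    intro z hz
    rw [SimpleGraph.Walk.support_map, List.mem_map] at hz
    obtain ⟨z', -, rfl⟩ := hz
    exact z'.2
  exact ⟨_, hp⟩

/-! ### Children and subtrees in a rooted tree decomposition -/

namespace TreeDecomposition

variable {V τ : Type*} {G : SimpleGraph V} {D : TreeDecomposition G τ}

theorem exists_isPath (D : TreeDecomposition G τ) (s t : τ) :
    ∃ p : D.tree.Walk s t, p.IsPath :=
  (D.isTree.existsUnique_path s t).exists

theorem mem_subtree_or_mem_subtree {t t' : τ} (h : D.tree.Adj t t') :
    t' ∈ D.subtree t ∨ t ∈ D.subtree t' := by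
  by_contra! hn
  obtain ⟨hn, hn'⟩ := hn
  simp only [subtree, Set.mem_ofPred_eq, not_forall] at hn
  obtain ⟨p, hp, ht⟩ := hn
  exact hn' fun q hq =>
    D.isTree.isAcyclic.mem_support_of_ne_mem_support_of_adj_of_isPath hq hp h ht

theorem parent_unique {t t₁ t₂ : τ} (h₁ : D.tree.Adj t t₁) (h₂ : D.tree.Adj t t₂)
    (ht₁ : t ∈ D.subtree t₁) (ht₂ : t ∈ D.subtree t₂) : t₁ = t₂ := by
  obtain ⟨p, hp⟩ := D.exists_isPath D.root t
  rw [D.isTree.isAcyclic.eq_penultimate_of_adj_end hp h₁ (ht₁ p hp),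
    D.isTree.isAcyclic.eq_penultimate_of_adj_end hp h₂ (ht₂ p hp)]

/-- The only way out of a child's subtree is the edge to its parent: a neighbour either extends the
root path of `s` or is its penultimate node. -/
theorem IsChild.mem_subtree_of_adj {t t₁ s s' : τ} (h : D.IsChild t t₁) (hs : s ∈ D.subtree t₁)
    (hadj : D.tree.Adj s s') (hs' : s' ≠ t) : s' ∈ D.subtree t₁ := by
  intro p hp
  obtain ⟨q, hq⟩ := D.exists_isPath D.root s
  have hT := D.isTree.isAcyclic
  by_cases hsp : s ∈ p.support
  · rw [hT.path_concat hq hp hadj hsp]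
    exact q.support_subset_support_concat _ (hs q hq)
  · have hs'q := hT.mem_support_of_ne_mem_support_of_adj_of_isPath hq hp hadj hsp
    have hmem := hs q hq
    have hqp := hT.path_concat hp hq hadj.symm hs'q
    rw [hqp, SimpleGraph.Walk.support_concat] at hmem
    simp only [List.mem_append, List.mem_cons, List.not_mem_nil, or_false] at hmem
    rcases hmem with hmem | rfl
    · exact hmem
    · refine absurd ?_ hs'
      rw [hT.eq_penultimate_of_adj_end hq hadj hs'q,
        hT.eq_penultimate_of_adj_end hq h.1.symm (h.2 q hq)]

theorem IsChild.mem_subtree_of_walk {t t₁ s s' : τ} (h : D.IsChild t t₁)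
    (hs : s ∈ D.subtree t₁) (p : D.tree.Walk s s') (ht : t ∉ p.support) : s' ∈ D.subtree t₁ := by
  induction p with
  | nil => exact hs
  | @cons u v w huv p ih =>
    rw [SimpleGraph.Walk.support_cons, List.mem_cons, not_or] at ht
    refine ih (h.mem_subtree_of_adj hs huv ?_) ht.2
    rintro rfl
    exact ht.2 p.start_mem_support

theorem IsChild.disjoint_subtree {t t₁ t₂ : τ} (h₁ : D.IsChild t t₁) (h₂ : D.IsChild t t₂)
    (hne : t₁ ≠ t₂) : Disjoint (D.subtree t₁) (D.subtree t₂) := by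
  rw [Set.disjoint_left]
  intro s hs₁ hs₂
  have hT := D.isTree.isAcyclic
  obtain ⟨p, hp⟩ := D.exists_isPath D.root s
  have hmem := hs₂ p hp
  have htq : t ∉ (p.dropUntil t₂ hmem).support := by
    intro ht
    have happ := hp
    rw [← p.take_spec hmem] at happ
    exact happ.ne_of_mem_support_of_append h₂.1.ne
      (h₂.2 _ (hp.takeUntil hmem)) ht rfl
  have hsub : t₂ ∈ D.subtree t₁ :=
    h₁.mem_subtree_of_walk hs₁ (p.dropUntil t₂ hmem).reverse (by simpa using htq)
  obtain ⟨r, hr⟩ := D.exists_isPath D.root t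
  obtain ⟨r₁, hr₁⟩ := D.exists_isPath D.root t₁
  obtain ⟨r₂, hr₂⟩ := D.exists_isPath D.root t₂
  have h := hsub r₂ hr₂
  rw [hT.path_concat hr hr₂ h₂.1 (h₂.2 _ hr₂), SimpleGraph.Walk.support_concat] at h
  simp only [List.mem_append, List.mem_cons, List.not_mem_nil, or_false] at h
  exact h.elim (hT.ne_mem_support_of_support_of_adj_of_isPath hr₁ hr h₁.1.symm (h₁.2 _ hr₁)) hne

/-- The nodes whose bags contain such a vertex are connected and avoid `t`, so they cannot meet two
child subtrees. -/
theorem IsChild.disjoint_subtreeBag_diff {t t₁ t₂ : τ} (h₁ : D.IsChild t t₁)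
    (h₂ : D.IsChild t t₂) (hne : t₁ ≠ t₂) :
    Disjoint (D.subtreeBag t₁ \ D.bag t) (D.subtreeBag t₂ \ D.bag t) := by
  rw [Set.disjoint_left]
  rintro v ⟨hv₁, hvt⟩ ⟨hv₂, -⟩
  simp only [subtreeBag, Set.mem_iUnion] at hv₁ hv₂
  obtain ⟨s₁, hs₁, hv₁⟩ := hv₁
  obtain ⟨s₂, hs₂, hv₂⟩ := hv₂
  obtain ⟨p, hp⟩ := walkConnected_of_induce_connected (D.connected_nodes v) s₁ hv₁ s₂ hv₂
  exact Set.disjoint_left.1 (h₁.disjoint_subtree h₂ hne)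
    (h₁.mem_subtree_of_walk hs₁ p fun ht => hvt (hp t ht)) hs₂

/-- The adhesions of `t` with its children. -/
def childAdhesions (D : TreeDecomposition G τ) (t : τ) : Set (Set V) :=
  {S | ∃ t', D.IsChild t t' ∧ S = D.bag t ∩ D.bag t'}

theorem ncard_adhesionsAt_le [Finite V] (D : TreeDecomposition G τ) (t : τ) :
    (D.adhesionsAt t).ncard ≤ (D.childAdhesions t).ncard + 1 := by
  let P : Set (Set V) := {S | ∃ t', D.tree.Adj t t' ∧ t ∈ D.subtree t' ∧ S = D.bag t ∩ D.bag t'}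
  have hP : P.ncard ≤ 1 := by
    rw [Set.ncard_le_one]
    rintro _ ⟨t₁, h₁, ht₁, rfl⟩ _ ⟨t₂, h₂, ht₂, rfl⟩
    rw [parent_unique h₁ h₂ ht₁ ht₂]
  have hsub : D.adhesionsAt t ⊆ D.childAdhesions t ∪ P := by
    rintro _ ⟨t', h, rfl⟩
    rcases mem_subtree_or_mem_subtree h with h' | h'
    · exact Or.inl ⟨t', ⟨h, h'⟩, rfl⟩
    · exact Or.inr ⟨t', h, h', rfl⟩
  have h1 := Set.ncard_le_ncard hsub
  have h2 := Set.ncard_union_le (D.childAdhesions t) P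
  omega

/-- Every tree edge demands a nonempty vertex set below it, so without vertices the tree has no
edges. This settles `ℓ = 0`. -/
theorem IsConnected.adhesionsAt_eq_empty [IsEmpty V] (hD : D.IsConnected) (t : τ) :
    D.adhesionsAt t = ∅ := by
  rw [Set.eq_empty_iff_forall_notMem]
  rintro _ ⟨t', h, -⟩
  rcases mem_subtree_or_mem_subtree h with h' | h'
  · obtain ⟨v⟩ := (hD t t' ⟨h, h'⟩).1.nonempty
    exact isEmptyElim v
  · obtain ⟨v⟩ := (hD t' t ⟨h.symm, h'⟩).1.nonempty
    exact isEmptyElim v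

theorem IsConnected.ncard_childAdhesions_le [Finite V] {W : Type*} {H : SimpleGraph W} {c : ℕ}
    (hc : ∀ (G' : SimpleGraph V) (A : Finset V), A.Nonempty → c * #A ≤ degSum G' A →
      HasSubdivision H.edgeSet G' A)
    (hH : ¬ IsTopologicalMinor H G) (hD : D.IsConnected) (t : τ) :
    (D.childAdhesions t).ncard ≤ (c + 2 ^ c) * (D.bag t).ncard + 1 := by
  have := Fintype.ofFinite V
  have : Fintype (D.childAdhesions t) := Fintype.ofFinite _
  choose k hk hS using fun S : D.childAdhesions t => S.2
  have hSk : ∀ (S : D.childAdhesions t) v, v ∈ (S : Set V).toFinset ↔ v ∈ D.bag t ∩ D.bag (k S) := fun S v => by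
    rw [Set.mem_toFinset, ← hS]
  have hkinj : Function.Injective k := fun S S' h => Subtype.ext (by rw [hS S, hS S', h])
  have := card_attached_le (C := fun S => D.subtreeBag (k S) \ D.bag t) hc hH
    (D.bag t).toFinset (fun S : D.childAdhesions t => (S : Set V).toFinset)
    (fun S v hv => Set.mem_toFinset.2 ((hSk S v).1 hv).1)
    (fun S S' h => Subtype.ext (Set.toFinset_inj.1 h))
    (fun S => walkConnected_of_induce_connected (hD t (k S) (hk S)).1)
    (fun S v hv => (hD t (k S) (hk S)).2 v ((hSk S v).1 hv))
    (fun S S' h => (hk S).disjoint_subtreeBag_diff (hk S') (hkinj.ne h))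
    (fun S => by
      rw [Set.coe_toFinset]
      exact Set.disjoint_sdiff_left)
  rwa [Set.ncard_eq_toFinset_card', Set.ncard_eq_toFinset_card' (D.bag t), Set.toFinset_card]

end TreeDecomposition

end AdhDeg

theorem lemma4p3 {W : Type*} [Finite W] (H : SimpleGraph W) :
    ∃ f : ℕ → ℕ, ∀ (h ℓ : ℕ) {V τ : Type*} [Finite V] [Fintype τ] (G : SimpleGraph V)
      (D : AdhDeg.TreeDecomposition G τ),
      ¬ AdhDeg.IsTopologicalMinor H G → D.IsConnected → D.width < (ℓ : ℤ) → D.adhesion ≤ h →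
        D.adhesionDegree ≤ f h * ℓ := by
  obtain ⟨c, -, hc⟩ := AdhDeg.exists_hasSubdivision_of_le_degSum H.edgeSet
  -- The extra 2 pays for the parent's adhesion and the empty clique, once `ℓ` is positive.
  refine ⟨fun _ => c + 2 ^ c + 2, fun _ ℓ {V τ} _ _ G D hH hD hw _ => Finset.sup_le fun t _ => ?_⟩
  have hbag : ∀ s, (D.bag s).ncard ≤ ℓ := by
    intro s
    have h1 : (D.bag s).ncard ≤ Finset.univ.sup fun t => (D.bag t).ncard :=
      Finset.le_sup (f := fun t => (D.bag t).ncard) (Finset.mem_univ s)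
    rw [AdhDeg.TreeDecomposition.width] at hw
    omega
  rcases Nat.eq_zero_or_pos ℓ with rfl | hℓ
  · have : IsEmpty V := by
      refine ⟨fun v => ?_⟩
      obtain ⟨s, hs⟩ := Set.mem_iUnion.1 (D.iUnion_bag ▸ Set.mem_univ v)
      exact ((Set.ncard_pos (Set.toFinite _)).2 ⟨v, hs⟩).ne' (Nat.le_zero.1 (hbag s))
    rw [hD.adhesionsAt_eq_empty t, Set.ncard_empty]
    exact Nat.zero_le _
  · have h1 := D.ncard_adhesionsAt_le t
    have h2 := hD.ncard_childAdhesions_le (fun G' A => hc G' A) hH t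
    have h3 := Nat.mul_le_mul_left (c + 2 ^ c) (hbag t)
    have h4 : (c + 2 ^ c + 2) * ℓ = (c + 2 ^ c) * ℓ + 2 * ℓ := add_mul _ _ _
    dsimp only
    omega
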